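/- A machine has status $X(t)\in\{0,1,2\}$ ($0$ = free, $1$ = busy with an internal job, $2$ = processing an external job), and a resource allocator keeps an estimate $\hat X(t)$ of it; initially $X(0)=\hat X(0)=0$. Let $\alpha,\beta,\gamma,\lambda,\mu>0$. While $X=0$, internal jobs arrive at rate $\alpha$ and change $X$ to $1$; while $X=1$, the internal job is completed at rate $\beta$ and $X$ becomes $0$; while $X=2$, the external job is completed at rate $\gamma$ and $X$ becomes $0$. The allocator samples the machine at rate $\mu$, whereupon $\hat X$ becomes equal to $X$. External job requests arrive at the allocator at rate $\lambda$; a request is rejected (with no change of state) if $\hat X\neq 0$ and accepted if $\hat X=0$. An accepted request makes $X=2$ if $X=0$, and is lost if $X\neq 0$; in both cases $\hat X$ is then set to the resulting status $X$. All events are Markovian, so that $Y(t)=(X(t),\hat X(t))$ is a continuous-time Markov chain on $S=\{0,1\}\times\{0,1\}\cup\{0,1,2\}\times\{2\}$; let $Q$ be its generator matrix. Let $N_A(T)$ and $N_R(T)$ be the numbers of requests accepted and rejected up to time $T$, $N_{FA}(T)$ the number of requests accepted while $X\ne 0$, and $N_{FR}(T)$ the number of requests rejected while $X=0$. Put $$\mathrm{FAR}=\mathbb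 E\Big[\limsup_{T\to\infty}\frac{N_{FA}(T)}{N_A(T)}\Big],\qquad \mathrm{FRR}=\mathbb E\Big[\limsup_{T\to\infty}\frac{N_{FR}(T)}{N_R(T)}\Big].$$ Then $Y$ has a unique stationary distribution $\pi=(\pi_{ij})_{(i,j)\in S}$ (the unique probability vector with $\pi Q=0$), and with $\kappa=\lambda+\alpha+\beta$ and $\tilde\beta=\lambda\beta(\lambda+\beta)+\gamma(\lambda\beta+\lambda\alpha+\alpha\kappa)$, $$\mathrm{FAR}=\frac{\pi_{10}}{\pi_{10}+\pi_{00}}=\frac{\alpha}{\mu+\kappa},$$ $$\mathrm{FRR}=\frac{\pi_{02}+\pi_{01}}{\pi_{02}+\pi_{01}+\pi_{12}+\pi_{11}+\pi_{22}}=\frac{\gamma\beta\,(\mu(\lambda+\alpha)+\lambda\kappa)}{(\alpha\gamma+\lambda\beta)\mu^2+\tilde\beta\mu+\gamma\lambda(\beta+\alpha)\kappa}.$$ -/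

import Mathlib

open MeasureTheory ProbabilityTheory Filter

noncomputable section

/-- The transition rates of a single Markov machine with its resource allocator. -/
structure MarkovMachine where
  /-- arrival rate of internal jobs (while the machine is free) -/
  α : ℝ
  /-- completion rate of internal jobs -/
  β : ℝ
  /-- completion rate of external jobs -/
  γ : ℝ
  /-- arrival rate of external job requests at the allocator -/
  lam : ℝ
  /-- rate at which the allocator samples the machine -/
  μ : ℝ
  α_pos : 0 < α
  β_pos : 0 < β
  γ_pos : 0 < γ
  lam_pos : 0 < lam
  μ_pos : 0 < μ

namespace MarkovMachine

/-- The status of the machine: free (`0`), busy with an internal job (`1`), or processing an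
external job (`2`). -/
inductive Status
  | free
  | busy
  | external
  deriving DecidableEq

instance : Fintype Status :=
  ⟨{.free, .busy, .external}, fun x => by cases x <;> simp⟩

/-- The events: arrival and completion of an internal job, completion of an external job,
sampling of the machine, and arrival of an external job request at the allocator. -/
inductive Event
  | internalArrival
  | internalCompletion
  | externalCompletion
  | sample
  | request
  deriving DecidableEq

instance : Fintype Event :=
  ⟨{.internalArrival, .internalCompletion, .externalCompletion, .sample, .request}, fun x => by cases x <;> simp⟩

/-- The seven-element state space `{0,1} × {0,1} ∪ {0,1,2} × {2}`: pairs (actual status, estimate)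
such that an external job is in progress only if the estimate is `external`. -/
abbrev State : Type :=
  {y : Status × Status // y.1 = Status.external → y.2 = Status.external}

/-- The status `X` of the machine in a state. -/
def State.machine (y : State) : Status := y.1.1

/-- The allocator's estimate of the status in a state. -/
def State.estimate (y : State) : Status := y.1.2

instance : MeasurableSpace Event := ⊤
instance : MeasurableSpace State := ⊤
instance : DiscreteMeasurableSpace Event := ⟨fun _ => trivial⟩
instance : DiscreteMeasurableSpace State := ⟨fun _ => trivial⟩

/-- The effect of an event on the pair (status, estimate). A sample sets the estimate to the actual
status. A request is rejected, without effect, unless the estimate is `free`; if it is `free`, the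
request is assigned to the machine, which starts processing it if it is free (otherwise the job is
lost), and the allocator learns the resulting status. -/
def movePair : Status × Status → Event → Status × Status
  | (.free, e), .internalArrival => (.busy, e)
  | (.busy, e), .internalCompletion => (.free, e)
  | (.external, e), .externalCompletion => (.free, e)
  | (x, _), .sample => (x, x)
  | (.free, .free), .request => (.external, .external)
  | (x, .free), .request => (x, x)
  | y, _ => y

lemma movePair_mem (y : State) (e : Event) :
    (movePair y.1 e).1 = Status.external → (movePair y.1 e).2 = Status.external := by
  revert y e
  decide

/-- The state after an event. -/
def move (y : State) (e : Event) : State := ⟨movePair y.1 e, movePair_mem y e⟩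

/-- The initial state `(0, 0)`: the machine is free and is estimated to be free. -/
def initial : State := ⟨(Status.free, Status.free), by decide⟩

variable (M : MarkovMachine)

/-- The rate at which an event occurs in a state. -/
def rate (y : State) : Event → ℝ
  | .internalArrival => if y.machine = Status.free then M.α else 0
  | .internalCompletion => if y.machine = Status.busy then M.β else 0
  | .externalCompletion => if y.machine = Status.external then M.γ else 0
  | .sample => M.μ
  | .request => M.lam

/-- The total rate of events in a state, including those events that do not change the state. -/
def totalRate (y : State) : ℝ := ∑ e, M.rate y e

/-! ### Stationary distribution -/

/-- The generator matrix of the continuous-time chain `Y = (X, estimate)`. -/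
def generator : Matrix State State ℝ := fun i j =>
  if i = j then -∑ k ∈ Finset.univ.erase i, ∑ e, (if move i e = k then M.rate i e else 0)
  else ∑ e, (if move i e = j then M.rate i e else 0)

/-- `π` is a probability vector with `π Q = 0`. -/
def IsStationary (π : State → ℝ) : Prop :=
  (∀ y, 0 ≤ π y) ∧ ∑ y, π y = 1 ∧ Matrix.vecMul π M.generator = 0

/-! ### The process

The process is given by its steps: the state before the event, the event, and the time spent
waiting for it. -/

/-- One step: the current state, the event that occurs next, and the waiting time for it. -/
abbrev Step : Type := State × Event × ℝ

lemma rate_nonneg (y : State) (e : Event) : 0 ≤ M.rate y e := by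
  have h1 := M.α_pos
  have h2 := M.β_pos
  have h3 := M.γ_pos
  have h4 := M.lam_pos
  have h5 := M.μ_pos
  cases e <;> simp only [rate] <;> positivity

lemma totalRate_pos (y : State) : 0 < M.totalRate y :=
  Finset.sum_pos' (fun e _ => M.rate_nonneg y e) ⟨Event.request, Finset.mem_univ _, M.lam_pos⟩

/-- In state `y` the next event is `e` with probability `rate y e / totalRate y`. -/
def eventLaw (y : State) : Measure Event :=
  ∑ e, ENNReal.ofReal (M.rate y e / M.totalRate y) • Measure.dirac e

instance (y : State) : IsProbabilityMeasure (M.eventLaw y) := by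
  constructor
  have h : ∑ e, M.rate y e / M.totalRate y = 1 := by
    rw [← Finset.sum_div]
    exact div_self (M.totalRate_pos y).ne'
  simp only [eventLaw, Measure.coe_finsetSum, Finset.sum_apply, Measure.smul_apply,
    measure_univ, smul_eq_mul, mul_one]
  rw [← ENNReal.ofReal_sum_of_nonneg, h, ENNReal.ofReal_one]
  exact fun e _ => div_nonneg (M.rate_nonneg y e) (M.totalRate_pos y).le

instance (y : State) : IsProbabilityMeasure (expMeasure (M.totalRate y)) :=
  isProbabilityMeasure_expMeasure (M.totalRate_pos y)

/-- The law of the step made from state `y`: the event and the waiting time are independent, and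
the waiting time is exponential with parameter `totalRate y`. -/
def stepLaw (y : State) : Measure Step :=
  (Measure.dirac y).prod ((M.eventLaw y).prod (expMeasure (M.totalRate y)))

instance (y : State) : IsProbabilityMeasure (M.stepLaw y) := by
  unfold stepLaw
  infer_instance

/-- The law of the next step as a Markov kernel from the current state. -/
def stepKernel : Kernel State Step where
  toFun := M.stepLaw
  measurable' := measurable_of_countable _

instance : IsMarkovKernel M.stepKernel :=
  ⟨fun y => inferInstanceAs (IsProbabilityMeasure (M.stepLaw y))⟩

/-- The state reached by the last of the steps `0, …, n`. -/
def nextState (n : ℕ) (h : Finset.Iic n → Step) : State :=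
  move (h ⟨n, Finset.mem_Iic.2 le_rfl⟩).1 (h ⟨n, Finset.mem_Iic.2 le_rfl⟩).2.1

lemma measurable_nextState (n : ℕ) : Measurable (nextState n) := by
  have h : Measurable fun p : State × Event => move p.1 p.2 := measurable_of_countable _
  have h' : Measurable fun s : Step => (s.1, s.2.1) := by fun_prop
  exact (h.comp h').comp (measurable_pi_apply _)

/-- The law of step `n + 1` given the steps `0, …, n`. -/
def historyKernel (n : ℕ) : Kernel (Finset.Iic n → Step) Step :=
  M.stepKernel.comap (nextState n) (measurable_nextState n)

instance (n : ℕ) : IsMarkovKernel (M.historyKernel n) := by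
  unfold historyKernel
  infer_instance

/-- The law of the whole process started in state `(0, 0)`. -/
def processLaw : Measure (ℕ → Step) :=
  Kernel.trajMeasure (X := fun _ => Step) (M.stepLaw initial) M.historyKernel

/-! ### Counting accepted and rejected requests -/

/-- The time at which the event of step `n` occurs. -/
def eventTime (ω : ℕ → Step) (n : ℕ) : ℝ := ∑ k ∈ Finset.range (n + 1), (ω k).2.2

/-- The number of external job requests up to time `T` that arrive while the state is in `A`. -/
def requestCount (A : Set State) (ω : ℕ → Step) (T : ℝ) : ℝ :=
  ({n : ℕ | eventTime ω n ≤ T ∧ (ω n).2.1 = Event.request ∧ (ω n).1 ∈ A}.ncard : ℝ)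

/-- The states in which the allocator accepts requests. -/
def acceptStates : Set State := {y | y.estimate = Status.free}

/-- The states in which the allocator accepts requests although the machine is not free. -/
def falseAcceptStates : Set State := {y | y.estimate = Status.free ∧ y.machine ≠ Status.free}

/-- The states in which the allocator rejects requests. -/
def rejectStates : Set State := {y | y.estimate ≠ Status.free}

/-- The states in which the allocator rejects requests although the machine is free. -/
def falseRejectStates : Set State := {y | y.estimate ≠ Status.free ∧ y.machine = Status.free}

/-- The false acceptance ratio: the expectation of the upper limit, as `T → ∞`, of the number of
false acceptances up to time `T` over the number of acceptances up to time `T`. -/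
def FAR : ℝ :=
  ∫ ω, limsup (fun T : ℝ =>
    requestCount falseAcceptStates ω T / requestCount acceptStates ω T) atTop ∂M.processLaw

/-- The false rejection ratio: the expectation of the upper limit, as `T → ∞`, of the number of
false rejections up to time `T` over the number of rejections up to time `T`. -/
def FRR : ℝ :=
  ∫ ω, limsup (fun T : ℝ =>
    requestCount falseRejectStates ω T / requestCount rejectStates ω T) atTop ∂M.processLaw

/-! ### The seven states, named by (actual status, estimate), and the constants -/

def s00 : State := ⟨(.free, .free), by decide⟩
def s10 : State := ⟨(.busy, .free), by decide⟩
def s01 : State := ⟨(.free, .busy), by decide⟩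
def s11 : State := ⟨(.busy, .busy), by decide⟩
def s02 : State := ⟨(.free, .external), by decide⟩
def s12 : State := ⟨(.busy, .external), by decide⟩
def s22 : State := ⟨(.external, .external), by decide⟩

/-- `κ = λ + α + β`. -/
def κ : ℝ := M.lam + M.α + M.β

/-- `β̃ = λβ(λ + β) + γ(λβ + λα + ακ)`. -/
def βt : ℝ :=
  M.lam * M.β * (M.lam + M.β) + M.γ * (M.lam * M.β + M.lam * M.α + M.α * M.κ)

end MarkovMachine

end

/-! By a PASTA-type argument, requests, arriving at the same rate in every state, see the chain in
its stationary distribution. So the long-run share of accepted (rejected) requests that are false is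
almost surely a ratio of stationary probabilities, and the expectation of the limsup is that
constant.

For a set `A` of states, take `h` solving the Poisson equation `Q h = λ (π(A) - 1_A)`
(`exists_poisson`). The request indicator on `A` plus the increment of `h` then has conditional mean
`λ π(A)` times the mean waiting time. The increments of `h` telescope to a bounded quantity, so a
law of large numbers for bounded martingale differences (`ae_tendsto_average_zero`, by fourth
moments) gives `stepCount A = λ π(A) · meanTime + o(n)` (`ae_tendsto_stepCount_sub`). In the ratio
of two counts the factor `λ · meanTime` cancels.

The chain does not explode, so counting up to time `T` amounts to counting up to a step index that
tends to infinity with `T` (`exists_requestCount_eq_stepCount`).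

The stationary distribution is explicit (`weight`), and it is unique because the left kernel of the
generator is a line. That fact also gives solvability of the Poisson equation. -/

open scoped Topology

/-! ### Law of large numbers by fourth moments -/

/-- A strong law of large numbers for uniformly bounded variables, each of which is orthogonal to
the sum of the preceding ones and to its cube. -/
lemma ae_tendsto_average_zero {Ω : Type*} [MeasurableSpace Ω] {P : Measure Ω}
    [IsProbabilityMeasure P] {D : ℕ → Ω → ℝ} (hD : ∀ n, Measurable (D n)) {C : ℝ}
    (hC : ∀ n ω, |D n ω| ≤ C)
    (h1 : ∀ n, ∫ ω, (∑ k ∈ Finset.range n, D k ω) * D n ω ∂P = 0)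
    (h3 : ∀ n, ∫ ω, (∑ k ∈ Finset.range n, D k ω) ^ 3 * D n ω ∂P = 0) :
    ∀ᵐ ω ∂P, Tendsto (fun n : ℕ => (∑ k ∈ Finset.range n, D k ω) / n) atTop (𝓝 0) := by
  set S : ℕ → Ω → ℝ := fun n ω => ∑ k ∈ Finset.range n, D k ω with hS
  have hSm : ∀ n, Measurable (S n) := fun n => Finset.measurable_sum _ fun k _ => hD k
  have hSb : ∀ n ω, |S n ω| ≤ n * C := fun n ω => by
    refine (Finset.abs_sum_le_sum_abs _ _).trans ((Finset.sum_le_sum fun k _ => hC k ω).trans ?_)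
    simp
  have hint : ∀ (i j n : ℕ), Integrable (fun ω => S n ω ^ i * D n ω ^ j) P := fun i j n => by
    refine Integrable.of_bound (((hSm n).pow_const i).mul ((hD n).pow_const j)).aestronglyMeasurable
      ((n * C) ^ i * C ^ j) (ae_of_all _ fun ω => ?_)
    rw [norm_mul, norm_pow, norm_pow, Real.norm_eq_abs, Real.norm_eq_abs]
    have := hSb n ω
    have := hC n ω
    have h0 : 0 ≤ C := (abs_nonneg _).trans this
    gcongr
  have hintS : ∀ i n : ℕ, Integrable (fun ω => S n ω ^ i) P := fun i n => by
    simpa using hint i 0 n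
  have hsucc : ∀ n ω, S (n + 1) ω = S n ω + D n ω := fun n ω => Finset.sum_range_succ _ _
  have hsq : ∀ n ω, D n ω ^ 2 ≤ C ^ 2 := fun n ω => sq_le_sq' (abs_le.1 (hC n ω)).1
    (abs_le.1 (hC n ω)).2
  have h2m : ∀ n : ℕ, ∫ ω, S n ω ^ 2 ∂P ≤ C ^ 2 * n := by
    intro n
    induction n with
    | zero => simp [hS]
    | succ n ih =>
      have hi1 : Integrable (fun ω => 2 * (S n ω * D n ω)) P := by
        simpa using (hint 1 1 n).const_mul 2
      have hi12 : Integrable (fun ω => S n ω ^ 2 + 2 * (S n ω * D n ω)) P := (hintS 2 n).add hi1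
      have hle : ∫ ω, S (n + 1) ω ^ 2 ∂P ≤ ∫ ω, (S n ω ^ 2 + 2 * (S n ω * D n ω) + C ^ 2) ∂P := by
        refine integral_mono (hintS 2 (n + 1)) ?_ fun ω => ?_
        · exact hi12.add (integrable_const _)
        · have := hsq n ω
          simp only [hsucc]
          linarith
      rw [integral_add hi12 (integrable_const _), integral_add (hintS 2 n) hi1, integral_const_mul,
        h1 n] at hle
      simp only [integral_const, probReal_univ, smul_eq_mul] at hle
      push_cast
      linarith
  -- Order `n ^ 2`, rather than `n ^ 4`, is what makes the fourth moments of `S n / n` summable.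
  have h4m : ∀ n : ℕ, ∫ ω, S n ω ^ 4 ∂P ≤ 8 * C ^ 4 * n ^ 2 := by
    intro n
    induction n with
    | zero => simp [hS]
    | succ n ih =>
      have hi3 : Integrable (fun ω => 4 * (S n ω ^ 3 * D n ω)) P := by
        simpa using (hint 3 1 n).const_mul 4
      have hi2 : Integrable (fun ω => 8 * C ^ 2 * S n ω ^ 2) P := (hintS 2 n).const_mul _
      have hi43 : Integrable (fun ω => S n ω ^ 4 + 4 * (S n ω ^ 3 * D n ω)) P := (hintS 4 n).add hi3
      have hi432 : Integrable
          (fun ω => S n ω ^ 4 + 4 * (S n ω ^ 3 * D n ω) + 8 * C ^ 2 * S n ω ^ 2) P := hi43.add hi2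
      have hle : ∫ ω, S (n + 1) ω ^ 4 ∂P ≤
          ∫ ω, (S n ω ^ 4 + 4 * (S n ω ^ 3 * D n ω) + 8 * C ^ 2 * S n ω ^ 2 + 3 * C ^ 4) ∂P := by
        refine integral_mono (hintS 4 (n + 1)) ?_ fun ω => ?_
        · exact hi432.add (integrable_const _)
        · have h2 := hsq n ω
          have h4 : D n ω ^ 4 ≤ C ^ 4 := by
            have := pow_le_pow_left₀ (sq_nonneg (D n ω)) h2 2
            calc D n ω ^ 4 = (D n ω ^ 2) ^ 2 := by ring
              _ ≤ (C ^ 2) ^ 2 := this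
              _ = C ^ 4 := by ring
          have h5 : S n ω ^ 2 * D n ω ^ 2 ≤ S n ω ^ 2 * C ^ 2 :=
            mul_le_mul_of_nonneg_left h2 (sq_nonneg _)
          -- Twice this gives `4 S D³ ≤ 2 S² D² + 2 D⁴`, which turns the binomial coefficients 6 and
          -- 1 of `S² D²` and `D⁴` into the constants 8 and 3.
          have h6 : 0 ≤ D n ω ^ 2 * (S n ω - D n ω) ^ 2 := by positivity
          simp only [hsucc]
          nlinarith [h4, h5, h6]
      rw [integral_add hi432 (integrable_const _), integral_add hi43 hi2,
        integral_add (hintS 4 n) hi3,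
        integral_const_mul, integral_const_mul, h3 n] at hle
      simp only [integral_const, probReal_univ, smul_eq_mul] at hle
      have h2 := mul_le_mul_of_nonneg_left (h2m n) (by positivity : 0 ≤ 8 * C ^ 2)
      have h0 : 0 ≤ C ^ 4 * n := by positivity
      have h0' : 0 ≤ C ^ 4 := by positivity
      push_cast
      nlinarith
  have hterm : ∀ n : ℕ, ∫⁻ ω, ENNReal.ofReal ((S n ω / n) ^ 4) ∂P
      ≤ ENNReal.ofReal (8 * C ^ 4 * (1 / (n : ℝ) ^ 2)) := fun n => by
    have hi : Integrable (fun ω => (S n ω / n) ^ 4) P := by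
      simpa only [div_pow] using (hintS 4 n).div_const _
    rw [← ofReal_integral_eq_lintegral_ofReal hi (ae_of_all _ fun ω => by positivity)]
    refine ENNReal.ofReal_le_ofReal ?_
    simp only [div_pow]
    rw [integral_div]
    rcases Nat.eq_zero_or_pos n with rfl | hn
    · simp
    · have hn' : (0 : ℝ) < n := by exact_mod_cast hn
      rw [div_le_iff₀ (by positivity)]
      refine (h4m n).trans (le_of_eq ?_)
      field_simp
  -- By Tonelli the series of `(S n / n) ^ 4` has finite expectation, so almost surely it converges
  -- and its terms tend to zero.
  have hsum : ∑' n : ℕ, ∫⁻ ω, ENNReal.ofReal ((S n ω / n) ^ 4) ∂P ≠ ⊤ :=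
    ne_top_of_le_ne_top
      ((Real.summable_one_div_nat_pow.2 (by norm_num)).mul_left (8 * C ^ 4)).tsum_ofReal_ne_top
      (ENNReal.tsum_le_tsum hterm)
  have hmeas : ∀ n : ℕ, Measurable fun ω => ENNReal.ofReal ((S n ω / n) ^ 4) := fun n =>
    (((hSm n).div_const _).pow_const 4).ennreal_ofReal
  rw [← lintegral_tsum fun n => (hmeas n).aemeasurable] at hsum
  filter_upwards [ae_lt_top (Measurable.tsum hmeas) hsum] with ω hω
  have h := (ENNReal.tendsto_toReal ENNReal.zero_ne_top).comp
    (ENNReal.tendsto_atTop_zero_of_tsum_ne_top hω.ne)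
  simp only [Function.comp_def, ENNReal.toReal_zero] at h
  have h' : Tendsto (fun n : ℕ => (S n ω / n) ^ 4) atTop (𝓝 0) := by
    refine h.congr fun n => ENNReal.toReal_ofReal (by positivity)
  rw [tendsto_zero_iff_abs_tendsto_zero]
  have h'' := h'.rpow_const (p := (1 / 4 : ℝ)) (Or.inr (by norm_num))
  rw [Real.zero_rpow (by norm_num)] at h''
  refine h''.congr fun n => ?_
  rw [← Even.pow_abs (by decide : Even 4)]
  rw [← Real.rpow_natCast, ← Real.rpow_mul (abs_nonneg _)]
  norm_num
  rfl

namespace MarkovMachine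

/-! ### Conditioning a step on its past -/

instance (M : MarkovMachine) : IsProbabilityMeasure M.processLaw := by
  unfold processLaw
  infer_instance

lemma map_frestrictLe_compProd_historyKernel (M : MarkovMachine) (n : ℕ) :
    M.processLaw.map (Preorder.frestrictLe (π := fun _ => Step) n) ⊗ₘ M.historyKernel n =
      M.processLaw.map fun ω => (Preorder.frestrictLe (π := fun _ => Step) n ω, ω (n + 1)) :=
  Kernel.map_frestrictLe_trajMeasure_compProd_eq_map_trajMeasure

lemma measurable_frestrictLe_prodMk (n : ℕ) : Measurable fun ω : ℕ → Step =>
    (Preorder.frestrictLe (π := fun _ => Step) n ω, ω (n + 1)) := by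
  fun_prop

lemma historyKernel_apply (M : MarkovMachine) (n : ℕ) (h : Finset.Iic n → Step) :
    M.historyKernel n h = M.stepLaw (nextState n h) := rfl

/-- A function of a step with mean zero, whatever the state from which the step is made, is
orthogonal to the functions of the past. -/
lemma integral_past_mul_eq_zero (M : MarkovMachine) (n : ℕ) {F : (Finset.Iic n → Step) → ℝ}
    {d : Step → ℝ} (hF : Measurable F) (hd : Measurable d) {B C : ℝ} (hB : ∀ h, |F h| ≤ B)
    (hC : ∀ s, |d s| ≤ C) (h0 : ∀ y, ∫ s, d s ∂M.stepLaw y = 0) :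
    ∫ ω, F (Preorder.frestrictLe n ω) * d (ω (n + 1)) ∂M.processLaw = 0 := by
  have hm : Measurable fun x : (Finset.Iic n → Step) × Step => F x.1 * d x.2 :=
    (hF.comp measurable_fst).mul (hd.comp measurable_snd)
  have h := integral_map (μ := M.processLaw) (measurable_frestrictLe_prodMk n).aemeasurable
    hm.aestronglyMeasurable
  rw [← map_frestrictLe_compProd_historyKernel] at h
  have : IsProbabilityMeasure
      (M.processLaw.map (Preorder.frestrictLe (π := fun _ => Step) n)) :=
    Measure.isProbabilityMeasure_map (by fun_prop)
  rw [Measure.integral_compProd] at h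
  · rw [← h]
    simp only [integral_const_mul, historyKernel_apply, h0, mul_zero, integral_zero]
  · refine Integrable.of_bound hm.aestronglyMeasurable (B * C) (ae_of_all _ fun x => ?_)
    rw [Real.norm_eq_abs, abs_mul]
    exact mul_le_mul (hB _) (hC _) (abs_nonneg _) ((abs_nonneg _).trans (hB x.1))

lemma ae_past_step (M : MarkovMachine) (n : ℕ) {p : (Finset.Iic n → Step) × Step → Prop}
    (hp : MeasurableSet {x | p x}) (h : ∀ x, ∀ᵐ s ∂M.stepLaw (nextState n x), p (x, s)) :
    ∀ᵐ ω ∂M.processLaw, p (Preorder.frestrictLe n ω, ω (n + 1)) := by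
  have h' : ∀ᵐ x ∂M.processLaw.map (Preorder.frestrictLe (π := fun _ => Step) n) ⊗ₘ
      M.historyKernel n, p x :=
    Measure.ae_compProd_of_ae_ae hp (ae_of_all _ h)
  rw [map_frestrictLe_compProd_historyKernel] at h'
  exact ae_of_ae_map (measurable_frestrictLe_prodMk n).aemeasurable h'

lemma map_eval_zero_processLaw (M : MarkovMachine) :
    M.processLaw.map (fun ω => ω 0) = M.stepLaw initial := by
  have h : (fun ω : ℕ → Step => ω 0) =
      (fun x : Finset.Iic 0 → Step => x ⟨0, by simp⟩) ∘
        (Preorder.frestrictLe (π := fun _ => Step) 0) := rfl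
  rw [h, ← Measure.map_map (by fun_prop) (by fun_prop)]
  unfold processLaw Kernel.trajMeasure
  rw [Measure.map_comp _ _ (by fun_prop), Kernel.traj_map_frestrictLe, Kernel.partialTraj_self,
    Measure.id_comp, Measure.map_map (by fun_prop) (by fun_prop)]
  exact Measure.map_id

lemma ae_step (M : MarkovMachine) {p : Step → Prop} (hp : MeasurableSet {s | p s})
    (h : ∀ y, ∀ᵐ s ∂M.stepLaw y, p s) : ∀ᵐ ω ∂M.processLaw, ∀ n, p (ω n) := by
  rw [ae_all_iff]
  rintro (_ | n)
  · have h0 := h initial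
    rw [← map_eval_zero_processLaw] at h0
    exact ae_of_ae_map (measurable_pi_apply 0).aemeasurable h0
  · exact M.ae_past_step n (p := fun x => p x.2) (hp.preimage measurable_snd) fun x => h _

lemma ae_stepLaw_fst (M : MarkovMachine) (y : State) : ∀ᵐ s ∂M.stepLaw y, s.1 = y := by
  have hm : MeasurableSet {s : Step | s.1 = y} :=
    (measurableSet_singleton y).preimage measurable_fst
  unfold stepLaw
  rw [Measure.dirac_prod, ae_map_iff (by fun_prop) hm]
  exact ae_of_all _ fun _ => rfl

lemma ae_stepLaw_wait_nonneg (M : MarkovMachine) (y : State) :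
    ∀ᵐ s ∂M.stepLaw y, 0 ≤ s.2.2 := by
  have h : ∀ᵐ w ∂expMeasure (M.totalRate y), 0 ≤ w := by
    unfold expMeasure gammaMeasure
    have hm : Measurable (gammaPDF 1 (M.totalRate y)) :=
      (measurable_gammaPDFReal 1 _).ennreal_ofReal
    rw [ae_withDensity_iff hm]
    refine ae_of_all _ fun w hw => ?_
    by_contra hlt
    exact hw (gammaPDF_of_neg (not_le.1 hlt))
  unfold stepLaw
  exact Measure.quasiMeasurePreserving_snd.ae (Measure.quasiMeasurePreserving_snd.ae h)

lemma ae_state_succ (M : MarkovMachine) :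
    ∀ᵐ ω ∂M.processLaw, ∀ n, (ω (n + 1)).1 = move (ω n).1 (ω n).2.1 := by
  rw [ae_all_iff]
  intro n
  refine M.ae_past_step n (p := fun x => x.2.1 = nextState n x.1) ?_ fun x => M.ae_stepLaw_fst _
  exact measurableSet_eq_fun (by fun_prop) ((measurable_nextState n).comp measurable_fst)

/-- For `G y e = h (move y e) - h y` the right-hand side is the generator applied to `h`, divided by
the total rate; this links the steps to the Poisson equation. -/
lemma integral_stepLaw_event (M : MarkovMachine) (y : State) (G : State → Event → ℝ) :
    ∫ s, G s.1 s.2.1 ∂M.stepLaw y = (∑ e, M.rate y e * G y e) / M.totalRate y := by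
  have h1 : ∫ s, G s.1 s.2.1 ∂M.stepLaw y = ∫ s, G y s.2.1 ∂M.stepLaw y :=
    integral_congr_ae ((M.ae_stepLaw_fst y).mono fun s hs => by simp only [hs])
  have h2 : (M.stepLaw y).map (fun s => s.2.1) = M.eventLaw y := by
    have : (fun s : Step => s.2.1) = Prod.fst ∘ Prod.snd := rfl
    rw [this, ← Measure.map_map measurable_fst measurable_snd, stepLaw, Measure.map_snd_prod,
      measure_univ, one_smul, Measure.map_fst_prod, measure_univ, one_smul]
  rw [h1, ← integral_map (φ := fun s : Step => s.2.1) (f := G y) (by fun_prop)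
    (measurable_of_countable _).aestronglyMeasurable, h2, eventLaw,
    integral_finsetSum_measure fun e _ =>
      (integrable_dirac (by simp)).smul_measure ENNReal.ofReal_ne_top, Finset.sum_div]
  refine Finset.sum_congr rfl fun e _ => ?_
  rw [integral_smul_measure, integral_dirac, ENNReal.toReal_ofReal
    (div_nonneg (M.rate_nonneg y e) (M.totalRate_pos y).le), smul_eq_mul]
  ring

/-- The integral is the exponential tail `exp (-totalRate y)`. It serves to exclude explosion: the
indicator is bounded, as the law of large numbers requires, whereas the waiting time is not. -/
lemma measure_wait_gt_one_pos (M : MarkovMachine) (y : State) :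
    0 < ∫ s, {s : Step | 1 < s.2.2}.indicator (1 : Step → ℝ) s ∂M.stepLaw y := by
  have hm : MeasurableSet {s : Step | 1 < s.2.2} :=
    measurableSet_lt measurable_const (by fun_prop)
  have h2 : (M.stepLaw y).map (fun s => s.2.2) = expMeasure (M.totalRate y) := by
    have : (fun s : Step => s.2.2) = Prod.snd ∘ Prod.snd := rfl
    rw [this, ← Measure.map_map measurable_snd measurable_snd, stepLaw, Measure.map_snd_prod,
      measure_univ, one_smul, Measure.map_snd_prod, measure_univ, one_smul]
  rw [integral_indicator_one hm]
  have h3 : (M.stepLaw y).real {s : Step | 1 < s.2.2} =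
      (expMeasure (M.totalRate y)).real (Set.Ioi 1) := by
    rw [← h2, map_measureReal_apply (by fun_prop) measurableSet_Ioi]
    rfl
  have h4 := cdf_expMeasure_eq (M.totalRate_pos y) 1
  rw [if_pos zero_le_one, cdf_eq_real] at h4
  rw [h3, ← Set.compl_Iic, probReal_compl_eq_one_sub measurableSet_Iic, h4]
  simpa using Real.exp_pos _

/-! ### Law of large numbers along the steps -/

/-- A function of a step with mean zero, whatever the state from which the step is made, is
orthogonal to the powers of the sum of its preceding values. -/
lemma integral_sum_pow_mul_eq_zero (M : MarkovMachine) {d : Step → ℝ}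
    (hd : Measurable d) {C : ℝ} (hC : ∀ s, |d s| ≤ C) (h0 : ∀ y, ∫ s, d s ∂M.stepLaw y = 0)
    {i : ℕ} (hi : i ≠ 0) (n : ℕ) :
    ∫ ω, (∑ k ∈ Finset.range n, d (ω k)) ^ i * d (ω n) ∂M.processLaw = 0 := by
  cases n with
  -- Step 0 has no past, but the empty sum to a nonzero power vanishes.
  | zero => simp [hi]
  | succ n =>
    have hsum : ∀ ω : ℕ → Step, ∑ k ∈ Finset.range (n + 1), d (ω k) =
        ∑ k : Finset.Iic n, d (Preorder.frestrictLe (π := fun _ => Step) n ω k) := fun ω => by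
      rw [Nat.range_succ_eq_Iic]
      exact (Finset.sum_coe_sort (Finset.Iic n) fun k => d (ω k)).symm
    simp only [hsum]
    have hF : Measurable fun h : Finset.Iic n → Step => (∑ k, d (h k)) ^ i :=
      (Finset.measurable_sum _ fun k _ => hd.comp (measurable_pi_apply k)).pow_const _
    have hB : ∀ h : Finset.Iic n → Step,
        |(∑ k, d (h k)) ^ i| ≤ (∑ _k : Finset.Iic n, C) ^ i := fun h => by
      rw [abs_pow]
      exact pow_le_pow_left₀ (abs_nonneg _) ((Finset.abs_sum_le_sum_abs _ _).trans
        (Finset.sum_le_sum fun k _ => hC _)) _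
    exact M.integral_past_mul_eq_zero n hF hd hB hC h0

lemma tendsto_average_zero_of_integral_eq_zero (M : MarkovMachine) {d : Step → ℝ}
    (hd : Measurable d) {C : ℝ} (hC : ∀ s, |d s| ≤ C) (h0 : ∀ y, ∫ s, d s ∂M.stepLaw y = 0) :
    ∀ᵐ ω ∂M.processLaw,
      Tendsto (fun n : ℕ => (∑ k ∈ Finset.range n, d (ω k)) / n) atTop (𝓝 0) := by
  have hm : ∀ n, Measurable fun ω : ℕ → Step => d (ω n) :=
    fun n => hd.comp (measurable_pi_apply n)
  have h1 : ∀ n, ∫ ω, (∑ k ∈ Finset.range n, d (ω k)) * d (ω n) ∂M.processLaw = 0 := by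
    intro n
    have h := M.integral_sum_pow_mul_eq_zero hd hC h0 one_ne_zero n
    simp only [pow_one] at h
    exact h
  have h3 : ∀ n, ∫ ω, (∑ k ∈ Finset.range n, d (ω k)) ^ 3 * d (ω n) ∂M.processLaw = 0 :=
    M.integral_sum_pow_mul_eq_zero hd hC h0 three_ne_zero
  exact ae_tendsto_average_zero hm (fun n ω => hC (ω n)) h1 h3

/-- Averages of a bounded function along the steps are asymptotically equal to the averages of its
conditional means. -/
lemma tendsto_average_sub_mean (M : MarkovMachine) {G : Step → ℝ} (hG : Measurable G) {C : ℝ}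
    (hC : ∀ s, |G s| ≤ C) :
    ∀ᵐ ω ∂M.processLaw, Tendsto (fun n : ℕ => (∑ k ∈ Finset.range n, G (ω k) -
      ∑ k ∈ Finset.range n, ∫ s, G s ∂M.stepLaw (ω k).1) / n) atTop (𝓝 0) := by
  set m : State → ℝ := fun y => ∫ s, G s ∂M.stepLaw y with hm
  have hmm : Measurable fun s : Step => m s.1 := (measurable_of_countable m).comp measurable_fst
  have hmC : ∀ y, |m y| ≤ C := fun y => by
    simpa using norm_integral_le_of_norm_le_const (μ := M.stepLaw y) (f := G) (ae_of_all _ hC)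
  -- Centring `G` at its conditional mean given the current state produces martingale differences
  -- bounded by `2 C`.
  have h := M.tendsto_average_zero_of_integral_eq_zero (d := fun s => G s - m s.1) (C := C + C)
    (hG.sub hmm) (fun s => (abs_sub _ _).trans (add_le_add (hC s) (hmC _))) fun y => by
      rw [integral_sub (Integrable.of_bound hG.aestronglyMeasurable C (ae_of_all _ hC))
        (Integrable.of_bound hmm.aestronglyMeasurable C (ae_of_all _ fun s => hmC _)),
        integral_congr_ae ((M.ae_stepLaw_fst y).mono fun s hs => by simp only [hs] :
          (fun s : Step => m s.1) =ᵐ[M.stepLaw y] fun _ => m y)]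
      simp [hm]
  simpa only [Finset.sum_sub_distrib] using h

/-! ### The generator and its left kernel -/

lemma sum_state (f : State → ℝ) :
    ∑ y, f y = f s00 + f s10 + f s01 + f s11 + f s02 + f s12 + f s22 := by
  have h : (Finset.univ : Finset State) = {s00, s10, s01, s11, s02, s12, s22} := by decide
  rw [h, Finset.sum_insert (by decide), Finset.sum_insert (by decide),
    Finset.sum_insert (by decide), Finset.sum_insert (by decide), Finset.sum_insert (by decide),
    Finset.sum_insert (by decide), Finset.sum_singleton]
  ring

lemma sum_event (f : Event → ℝ) :
    ∑ e, f e = f .internalArrival + f .internalCompletion + f .externalCompletion + f .sample +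
      f .request := by
  have h : (Finset.univ : Finset Event) = {.internalArrival, .internalCompletion,
    .externalCompletion, .sample, .request} := by decide
  rw [h, Finset.sum_insert (by decide), Finset.sum_insert (by decide),
    Finset.sum_insert (by decide), Finset.sum_insert (by decide), Finset.sum_singleton]
  ring

lemma generator_mulVec (M : MarkovMachine) (h : State → ℝ) (y : State) :
    M.generator.mulVec h y = ∑ e, M.rate y e * (h (move y e) - h y) := by
  have h1 : M.generator.mulVec h y = ∑ j ∈ Finset.univ.erase y,
      (∑ e, if move y e = j then M.rate y e else 0) * (h j - h y) := by
    rw [Matrix.mulVec, dotProduct, ← Finset.add_sum_erase _ _ (Finset.mem_univ y)]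
    have h2 : ∀ j ∈ Finset.univ.erase y, M.generator y j * h j =
        (∑ e, if move y e = j then M.rate y e else 0) * h j := fun j hj => by
      rw [generator, if_neg (Finset.ne_of_mem_erase hj).symm]
    rw [Finset.sum_congr rfl h2, generator, if_pos rfl]
    simp only [mul_sub, Finset.sum_sub_distrib, ← Finset.sum_mul]
    ring
  -- The term `j = y` carries the factor `h y - h y = 0`, so events that leave the state unchanged
  -- may be included.
  rw [h1, Finset.sum_erase _ (by simp)]
  simp only [Finset.sum_mul]
  rw [Finset.sum_comm]
  refine Finset.sum_congr rfl fun e _ => ?_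
  simp [ite_mul]

/-- The weak form of the balance equations, one line for each source state: with indicator functions
for `h` it yields the individual equations. From `s10` both a sample and a request lead to `s11`,
hence the rate `μ + λ`. -/
lemma dotProduct_generator_mulVec (M : MarkovMachine) (v h : State → ℝ) :
    v ⬝ᵥ M.generator.mulVec h =
      v s00 * (M.α * (h s10 - h s00) + M.lam * (h s22 - h s00)) +
      v s10 * (M.β * (h s00 - h s10) + (M.μ + M.lam) * (h s11 - h s10)) +
      v s01 * (M.α * (h s11 - h s01) + M.μ * (h s00 - h s01)) +
      v s11 * (M.β * (h s01 - h s11)) +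
      v s02 * (M.α * (h s12 - h s02) + M.μ * (h s00 - h s02)) +
      v s12 * (M.β * (h s02 - h s12) + M.μ * (h s11 - h s12)) +
      v s22 * (M.γ * (h s02 - h s22)) := by
  simp only [dotProduct, generator_mulVec, sum_state, sum_event]
  simp only [rate, State.machine, s00, s10, s01, s11, s02, s12, s22, move, movePair]
  simp only [reduceCtorEq, if_true, if_false]
  ring

/-- A stationary measure of the chain, normalized by its value `1` at `s00`. -/
noncomputable def weight (M : MarkovMachine) (y : State) : ℝ :=
  match y.1 with
  | (.free, .free) => 1
  | (.busy, .free) => M.α / (M.β + M.μ + M.lam)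
  | (.free, .external) => M.lam * (M.β + M.μ) / (M.μ * (M.α + M.β + M.μ))
  | (.busy, .external) => M.lam * M.α / (M.μ * (M.α + M.β + M.μ))
  | (.free, .busy) => (M.μ + M.lam) * M.α / (M.μ * (M.β + M.μ + M.lam)) +
      M.lam * M.α / (M.μ * (M.α + M.β + M.μ))
  | (.busy, .busy) => (M.α + M.μ) / M.β * ((M.μ + M.lam) * M.α / (M.μ * (M.β + M.μ + M.lam)) +
      M.lam * M.α / (M.μ * (M.α + M.β + M.μ)))
  | (.external, _) => M.lam / M.γ

lemma weight_pos (M : MarkovMachine) (y : State) : 0 < M.weight y := by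
  have h1 := M.α_pos
  have h2 := M.β_pos
  have h3 := M.γ_pos
  have h4 := M.lam_pos
  have h5 := M.μ_pos
  unfold weight
  split <;> positivity

lemma weight_vecMul_generator (M : MarkovMachine) : Matrix.vecMul M.weight M.generator = 0 := by
  have h1 := M.α_pos
  have h2 := M.β_pos
  have h3 := M.γ_pos
  have h4 := M.lam_pos
  have h5 := M.μ_pos
  refine dotProduct_eq_zero _ fun h => ?_
  rw [← Matrix.dotProduct_mulVec, dotProduct_generator_mulVec]
  simp only [weight, s00, s10, s01, s11, s02, s12, s22]
  field_simp
  ring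

/-- Once the value at `s00` is zero, the balance equations can be solved successively: `s10` and
`s22` receive flow only from `s00`, then come the pair `s02`, `s12` and the pair `s01`, `s11`. -/
lemma eq_zero_of_vecMul_generator (M : MarkovMachine) {u : State → ℝ}
    (hu : Matrix.vecMul u M.generator = 0) (h00 : u s00 = 0) : u = 0 := by
  have h1 := M.α_pos
  have h2 := M.β_pos
  have h3 := M.γ_pos
  have h4 := M.lam_pos
  have h5 := M.μ_pos
  have e : ∀ j, u ⬝ᵥ M.generator.mulVec (fun y => if y = j then 1 else 0) = 0 := fun j => by
    rw [Matrix.dotProduct_mulVec, hu, zero_dotProduct]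
  simp only [dotProduct_generator_mulVec, h00] at e
  have e10 := e s10
  have e11 := e s11
  have e02 := e s02
  have e12 := e s12
  have e22 := e s22
  have e01 := e s01
  simp +decide only [if_true, if_false] at e10 e11 e02 e12 e22 e01
  have u10 : u s10 = 0 := by
    refine (mul_eq_zero.1 (?_ : (M.β + M.μ + M.lam) * u s10 = 0)).resolve_left (by positivity)
    linarith
  have u22 : u s22 = 0 := by
    refine (mul_eq_zero.1 (?_ : M.γ * u s22 = 0)).resolve_left (by positivity)
    linarith
  have u02 : u s02 = 0 := by
    refine (mul_eq_zero.1 (?_ : (M.μ * (M.α + M.β + M.μ)) * u s02 = 0)).resolve_left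
      (by positivity)
    rw [u22] at e02
    -- The multipliers eliminate `u s12` from the equations at `s02` and `s12`.
    linear_combination (-(M.β + M.μ)) * e02 - M.β * e12
  have u12 : u s12 = 0 := by
    refine (mul_eq_zero.1 (?_ : (M.β + M.μ) * u s12 = 0)).resolve_left (by positivity)
    rw [u02] at e12
    linarith
  rw [u10, u12] at e11
  have u01 : u s01 = 0 := by
    refine (mul_eq_zero.1 (?_ : M.μ * u s01 = 0)).resolve_left (by positivity)
    linarith
  have u11 : u s11 = 0 := by
    refine (mul_eq_zero.1 (?_ : M.β * u s11 = 0)).resolve_left (by positivity)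
    rw [u01] at e11
    linarith
  have hall : ∀ y : State, y = s00 ∨ y = s10 ∨ y = s01 ∨ y = s11 ∨ y = s02 ∨ y = s12 ∨
    y = s22 := by decide
  funext y
  rcases hall y with rfl | rfl | rfl | rfl | rfl | rfl | rfl <;> assumption

lemma eq_smul_weight (M : MarkovMachine) {v : State → ℝ}
    (hv : Matrix.vecMul v M.generator = 0) : v = v s00 • M.weight := by
  refine sub_eq_zero.1 (M.eq_zero_of_vecMul_generator ?_ ?_)
  · rw [Matrix.sub_vecMul, Matrix.smul_vecMul, hv, weight_vecMul_generator, smul_zero, sub_zero]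
  · simp [weight, s00]

/-- Fredholm alternative: if `g` were outside the range, some functional would vanish on the range
but not at `g`. Such a functional is a left null vector, hence a multiple of `weight`, which
annihilates `g`. -/
lemma exists_generator_mulVec_eq (M : MarkovMachine) {g : State → ℝ}
    (hg : M.weight ⬝ᵥ g = 0) : ∃ h, M.generator.mulVec h = g := by
  by_contra hne
  have hmem : g ∉ LinearMap.range M.generator.mulVecLin := by
    rintro ⟨h, hh⟩
    exact hne ⟨h, hh⟩
  obtain ⟨φ, hφ, hle⟩ := Submodule.exists_le_ker_of_notMem hmem
  obtain ⟨v, rfl⟩ := (dotProductEquiv ℝ State).surjective φ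
  have hv : Matrix.vecMul v M.generator = 0 := dotProduct_eq_zero _ fun h => by
    rw [← Matrix.dotProduct_mulVec]
    exact hle ⟨h, rfl⟩
  apply hφ
  rw [dotProductEquiv_apply_apply, M.eq_smul_weight hv, smul_dotProduct, hg, smul_zero]

/-! ### Stationary distribution and Poisson equation -/

/-- The stationary distribution. -/
noncomputable def stationary (M : MarkovMachine) (y : State) : ℝ := M.weight y / ∑ x, M.weight x

lemma sum_weight_pos (M : MarkovMachine) : 0 < ∑ x, M.weight x :=
  Finset.sum_pos (fun y _ => M.weight_pos y) ⟨s00, Finset.mem_univ _⟩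

lemma stationary_pos (M : MarkovMachine) (y : State) : 0 < M.stationary y :=
  div_pos (M.weight_pos y) M.sum_weight_pos

lemma sum_stationary (M : MarkovMachine) : ∑ y, M.stationary y = 1 := by
  simp only [stationary]
  rw [← Finset.sum_div, div_self M.sum_weight_pos.ne']

lemma isStationary_stationary (M : MarkovMachine) : M.IsStationary M.stationary := by
  refine ⟨fun y => (M.stationary_pos y).le, M.sum_stationary, ?_⟩
  have h : M.stationary = (∑ x, M.weight x)⁻¹ • M.weight := funext fun y => by
    simp only [stationary, Pi.smul_apply, smul_eq_mul]
    ring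
  rw [h, Matrix.smul_vecMul, weight_vecMul_generator, smul_zero]

lemma IsStationary.eq_stationary {M : MarkovMachine} {p : State → ℝ} (hp : M.IsStationary p) :
    p = M.stationary := by
  have h := M.eq_smul_weight hp.2.2
  have h1 : p s00 * ∑ x, M.weight x = 1 := by
    rw [← hp.2.1, Finset.mul_sum]
    exact Finset.sum_congr rfl fun y _ => (congrFun h y).symm
  funext y
  rw [stationary, eq_div_iff M.sum_weight_pos.ne', congrFun h y, Pi.smul_apply, smul_eq_mul,
    mul_right_comm, h1, one_mul]

open Classical in
/-- The Poisson equation for the indicator function of a set of states. -/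
lemma exists_poisson (M : MarkovMachine) (A : Set State) :
    ∃ h : State → ℝ, ∀ y, (∑ e, M.rate y e * (h (move y e) - h y)) +
      M.lam * (if y ∈ A then 1 else 0) =
        M.lam * ∑ x, if x ∈ A then M.stationary x else 0 := by
  -- Subtracting the stationary mean makes this function orthogonal to `weight`, the solvability
  -- condition.
  obtain ⟨h, hh⟩ := M.exists_generator_mulVec_eq (g := fun y =>
    M.lam * (∑ x, if x ∈ A then M.stationary x else 0) - M.lam * (if y ∈ A then 1 else 0)) (by
      have hw : ∀ y, M.weight y = M.stationary y * ∑ x, M.weight x := fun y =>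
        (div_mul_cancel₀ _ M.sum_weight_pos.ne').symm
      simp only [dotProduct, mul_sub, Finset.sum_sub_distrib, ← Finset.sum_mul]
      rw [sub_eq_zero, mul_left_comm, mul_left_comm, Finset.mul_sum, Finset.mul_sum]
      refine Finset.sum_congr rfl fun y _ => ?_
      by_cases hy : y ∈ A
      · simp only [hy, if_true, hw y]
        ring
      · simp [hy])
  refine ⟨h, fun y => ?_⟩
  rw [← generator_mulVec, hh]
  ring

/-! ### Closed forms of the stationary ratios -/

lemma stationary_falseAccept_ratio (M : MarkovMachine) :
    M.stationary s10 / (M.stationary s10 + M.stationary s00) = M.α / (M.μ + M.κ) := by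
  have h1 := M.α_pos
  have h2 := M.β_pos
  have h4 := M.lam_pos
  have h5 := M.μ_pos
  simp only [stationary]
  rw [← add_div, div_div_div_cancel_right₀ M.sum_weight_pos.ne']
  simp only [weight, s00, s10, κ]
  field_simp
  ring

lemma stationary_falseReject_ratio (M : MarkovMachine) :
    (M.stationary s02 + M.stationary s01) / (M.stationary s02 + M.stationary s01 +
      M.stationary s12 + M.stationary s11 + M.stationary s22) =
      M.γ * M.β * (M.μ * (M.lam + M.α) + M.lam * M.κ) /
        ((M.α * M.γ + M.lam * M.β) * M.μ ^ 2 + M.βt * M.μ +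
          M.γ * M.lam * (M.β + M.α) * M.κ) := by
  have h1 := M.α_pos
  have h2 := M.β_pos
  have h3 := M.γ_pos
  have h4 := M.lam_pos
  have h5 := M.μ_pos
  simp only [stationary]
  simp only [← add_div]
  rw [div_div_div_cancel_right₀ M.sum_weight_pos.ne']
  simp only [weight, s01, s02, s11, s12, s22, κ, βt]
  rw [div_eq_div_iff (by positivity) (by positivity)]
  field_simp
  ring

/-! ### Request counts along the steps -/

open Classical in
/-- The number of requests among the steps `0, …, n - 1` that arrive while the state is in `A`. -/
noncomputable def stepCount (A : Set State) (ω : ℕ → Step) (n : ℕ) : ℝ :=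
  ∑ k ∈ Finset.range n, if (ω k).2.1 = Event.request ∧ (ω k).1 ∈ A then 1 else 0

/-- The sum of the mean waiting times of the steps `0, …, n - 1`. -/
noncomputable def meanTime (M : MarkovMachine) (ω : ℕ → Step) (n : ℕ) : ℝ :=
  ∑ k ∈ Finset.range n, (M.totalRate (ω k).1)⁻¹

open Classical in
/-- The stationary probability of a set of states. -/
noncomputable def stationaryProb (M : MarkovMachine) (A : Set State) : ℝ :=
  ∑ x, if x ∈ A then M.stationary x else 0

lemma exists_pos_forall_le {f : State → ℝ} (hf : ∀ y, 0 < f y) : ∃ δ, 0 < δ ∧ ∀ y, δ ≤ f y := by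
  obtain ⟨y, -, hy⟩ := Finset.exists_min_image Finset.univ f ⟨s00, Finset.mem_univ _⟩
  exact ⟨f y, hf y, fun x => hy x (Finset.mem_univ _)⟩

lemma exists_forall_abs_le (f : State → ℝ) : ∃ B, ∀ y, |f y| ≤ B := by
  obtain ⟨y, -, hy⟩ := Finset.exists_max_image Finset.univ (fun x => |f x|)
    ⟨s00, Finset.mem_univ _⟩
  exact ⟨|f y|, fun x => hy x (Finset.mem_univ _)⟩

/-- If two sums differ by `o(n)` and the second grows linearly, so does the first. -/
lemma exists_pos_eventually_mul_le {u v : ℕ → ℝ}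
    (h : Tendsto (fun n : ℕ => (u n - v n) / n) atTop (𝓝 0)) {δ : ℝ} (hδ : 0 < δ)
    (hv : ∀ n : ℕ, δ * n ≤ v n) : ∀ᶠ n : ℕ in atTop, δ / 2 * n ≤ u n := by
  filter_upwards [h.eventually_const_lt (by linarith : -(δ / 2) < 0), eventually_gt_atTop 0]
    with n hn hn0
  have hn' : (0 : ℝ) < n := by exact_mod_cast hn0
  rw [lt_div_iff₀ hn'] at hn
  linarith [hv n]

lemma tendsto_div_of_linear {u v : ℕ → ℝ} {c : ℝ}
    (h : Tendsto (fun n : ℕ => (u n - c * v n) / n) atTop (𝓝 0)) {δ : ℝ} (hδ : 0 < δ)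
    (hv : ∀ n : ℕ, δ * n ≤ v n) : Tendsto (fun n => u n / v n) atTop (𝓝 c) := by
  rw [tendsto_iff_norm_sub_tendsto_zero]
  have h' : Tendsto (fun n : ℕ => δ⁻¹ * |(u n - c * v n) / n|) atTop (𝓝 0) := by
    simpa using h.abs.const_mul δ⁻¹
  refine squeeze_zero' (Eventually.of_forall fun _ => norm_nonneg _) ?_ h'
  filter_upwards [eventually_gt_atTop 0] with n hn0
  have hn' : (0 : ℝ) < n := by exact_mod_cast hn0
  have hvn : 0 < v n := (by positivity : 0 < δ * n).trans_le (hv n)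
  have he : u n / v n - c = (u n - c * v n) / v n := by field_simp
  rw [he, Real.norm_eq_abs, abs_div, abs_div, abs_of_pos hvn, abs_of_pos hn', ← div_eq_inv_mul,
    div_div]
  exact div_le_div_of_nonneg_left (abs_nonneg _) (by positivity) (by linarith [hv n])

lemma exists_mul_le_meanTime (M : MarkovMachine) :
    ∃ δ, 0 < δ ∧ ∀ ω (n : ℕ), δ * n ≤ M.meanTime ω n := by
  obtain ⟨δ, hδ, h⟩ := exists_pos_forall_le fun y => inv_pos.2 (M.totalRate_pos y)
  refine ⟨δ, hδ, fun ω n => ?_⟩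
  calc δ * n = ∑ _k ∈ Finset.range n, δ := by simp [mul_comm]
    _ ≤ _ := Finset.sum_le_sum fun k _ => h _

/-- Total rates vary with the state, so the embedded chain need not have `stationary` as its
invariant law; measuring by `meanTime` instead of `n` corrects for this. -/
lemma ae_tendsto_stepCount_sub (M : MarkovMachine) (A : Set State) :
    ∀ᵐ ω ∂M.processLaw, Tendsto (fun n : ℕ => (stepCount A ω n -
      M.lam * M.stationaryProb A * M.meanTime ω n) / n) atTop (𝓝 0) := by
  classical
  obtain ⟨h, hh⟩ := M.exists_poisson A
  set G : State → Event → ℝ := fun y e =>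
    (if e = Event.request ∧ y ∈ A then 1 else 0) + (h (move y e) - h y) with hG
  obtain ⟨B, hB⟩ := exists_forall_abs_le h
  have hGB : ∀ y e, |G y e| ≤ 1 + (B + B) := fun y e => by
    refine (abs_add_le _ _).trans (add_le_add ?_ ((abs_sub _ _).trans (add_le_add (hB _) (hB _))))
    split_ifs <;> simp
  have hGm : Measurable fun s : Step => G s.1 s.2.1 :=
    (measurable_of_countable fun p : State × Event => G p.1 p.2).comp
      (by fun_prop : Measurable fun s : Step => (s.1, s.2.1))
  have hmean : ∀ y, ∫ s, G s.1 s.2.1 ∂M.stepLaw y =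
      M.lam * M.stationaryProb A * (M.totalRate y)⁻¹ := fun y => by
    rw [integral_stepLaw_event, ← div_eq_mul_inv]
    congr 1
    rw [stationaryProb, ← hh y]
    simp only [hG, mul_add, Finset.sum_add_distrib]
    rw [add_comm]
    congr 1
    by_cases hy : y ∈ A <;> simp [hy, rate]
  have hlim : Tendsto (fun n : ℕ => (B + B) / (n : ℝ)) atTop (𝓝 0) :=
    tendsto_const_div_atTop_nhds_zero_nat _
  filter_upwards [M.tendsto_average_sub_mean hGm fun s => hGB _ _, M.ae_state_succ] with ω h1 h2
  have h3 : Tendsto (fun n : ℕ => (h (ω 0).1 - h (ω n).1) / (n : ℝ)) atTop (𝓝 0) := by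
    refine squeeze_zero_norm (fun n => ?_) hlim
    rw [norm_div, Real.norm_eq_abs, Real.norm_natCast]
    gcongr
    exact (abs_sub _ _).trans (add_le_add (hB _) (hB _))
  have h4 := h1.add h3
  rw [add_zero] at h4
  refine h4.congr fun n => ?_
  rw [← add_div]
  congr 1
  -- Along the path `move` gives the next state, so the increments of `h` telescope.
  have h5 : ∑ k ∈ Finset.range n, G (ω k).1 (ω k).2.1 =
      stepCount A ω n + (h (ω n).1 - h (ω 0).1) := by
    rw [← Finset.sum_range_sub (fun k => h (ω k).1), stepCount, ← Finset.sum_add_distrib]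
    refine Finset.sum_congr rfl fun k _ => ?_
    rw [h2 k]
  rw [h5]
  simp only [hmean, meanTime, ← Finset.mul_sum]
  ring

/-- `meanTime` is a common scale for both counts and cancels, so it never has to be compared with
the real elapsed time. -/
lemma ae_tendsto_stepCount_ratio (M : MarkovMachine) (A B : Set State)
    (hB : M.stationaryProb B ≠ 0) :
    ∀ᵐ ω ∂M.processLaw, Tendsto (fun n => stepCount A ω n / stepCount B ω n) atTop
      (𝓝 (M.stationaryProb A / M.stationaryProb B)) := by
  obtain ⟨δ, hδ, hτ⟩ := M.exists_mul_le_meanTime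
  filter_upwards [M.ae_tendsto_stepCount_sub A, M.ae_tendsto_stepCount_sub B] with ω hA hB'
  have h := (tendsto_div_of_linear hA hδ (hτ ω)).div (tendsto_div_of_linear hB' hδ (hτ ω))
    (mul_ne_zero M.lam_pos.ne' hB)
  rw [mul_div_mul_left _ _ M.lam_pos.ne'] at h
  refine h.congr' ?_
  filter_upwards [eventually_gt_atTop 0] with n hn
  have hn' : (0 : ℝ) < n := by exact_mod_cast hn
  have hp : 0 < M.meanTime ω n := (by positivity : 0 < δ * n).trans_le (hτ ω n)
  exact div_div_div_cancel_right₀ hp.ne' _ _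

/-! ### From steps to real time -/

lemma ae_monotone_eventTime (M : MarkovMachine) : ∀ᵐ ω ∂M.processLaw, Monotone (eventTime ω) := by
  filter_upwards [M.ae_step (p := fun s => 0 ≤ s.2.2)
    (measurableSet_le measurable_const (by fun_prop)) M.ae_stepLaw_wait_nonneg] with ω h
  refine monotone_nat_of_le_succ fun n => ?_
  rw [eventTime, eventTime, Finset.sum_range_succ _ (n + 1)]
  linarith [h (n + 1)]

/-- The process does not explode. -/
lemma ae_tendsto_eventTime_atTop (M : MarkovMachine) :
    ∀ᵐ ω ∂M.processLaw, Tendsto (eventTime ω) atTop atTop := by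
  have hm : MeasurableSet {s : Step | 1 < s.2.2} :=
    measurableSet_lt measurable_const (by fun_prop)
  obtain ⟨δ, hδ, hle⟩ := exists_pos_forall_le M.measure_wait_gt_one_pos
  filter_upwards [M.ae_step (p := fun s => 0 ≤ s.2.2)
    (measurableSet_le measurable_const (by fun_prop)) M.ae_stepLaw_wait_nonneg,
    M.tendsto_average_sub_mean (G := {s : Step | 1 < s.2.2}.indicator (1 : Step → ℝ)) (C := 1)
      (measurable_one.indicator hm) fun s => by
        by_cases hs : s ∈ {s : Step | 1 < s.2.2} <;> simp [hs]] with ω h0 h1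
  have h2 := exists_pos_eventually_mul_le h1 hδ fun n => by
    calc δ * n = ∑ _k ∈ Finset.range n, δ := by simp [mul_comm]
      _ ≤ _ := Finset.sum_le_sum fun k _ => hle _
  have h3 : Tendsto (fun n : ℕ => δ / 2 * (n : ℝ)) atTop atTop :=
    tendsto_natCast_atTop_atTop.const_mul_atTop (by positivity)
  have h4 : Tendsto (fun n => ∑ k ∈ Finset.range n, (ω k).2.2) atTop atTop := by
    refine tendsto_atTop_mono' _ (h2.mono fun n hn => hn.trans ?_) h3
    -- A nonnegative waiting time dominates the indicator that it exceeds 1.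
    refine Finset.sum_le_sum fun k _ => ?_
    by_cases hk : 1 < (ω k).2.2
    · simpa [Set.indicator, hk] using hk.le
    · simpa [Set.indicator, hk] using h0 k
  -- `eventTime ω n` includes the waiting time of step `n`, hence `n + 1` terms.
  exact h4.comp (tendsto_add_atTop_nat 1)

/-- `N T` is the first index whose event falls after `T`. It exists because event times diverge, and
by monotonicity the events up to `T` are exactly the steps before it. The same `N` works for all
`A`, so ratios of counts transfer too. -/
lemma exists_requestCount_eq_stepCount {ω : ℕ → Step} (hmono : Monotone (eventTime ω))
    (htop : Tendsto (eventTime ω) atTop atTop) :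
    ∃ N : ℝ → ℕ, Tendsto N atTop atTop ∧
      ∀ A T, requestCount A ω T = stepCount A ω (N T) := by
  classical
  have hex : ∀ T, ∃ n, T < eventTime ω n := fun T => (htop.eventually_gt_atTop T).exists
  have hiff : ∀ T n, eventTime ω n ≤ T ↔ n < Nat.find (hex T) := fun T n => by
    rw [Nat.lt_find_iff]
    exact ⟨fun h m hm => not_lt.2 ((hmono hm).trans h), fun h => not_lt.1 (h n le_rfl)⟩
  refine ⟨fun T => Nat.find (hex T), tendsto_atTop.2 fun m => ?_, fun A T => ?_⟩
  · filter_upwards [eventually_ge_atTop (eventTime ω m)] with T hT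
    exact ((hiff T m).1 hT).le
  · have hset : {n : ℕ | eventTime ω n ≤ T ∧ (ω n).2.1 = Event.request ∧ (ω n).1 ∈ A} =
        (((Finset.range (Nat.find (hex T))).filter fun n =>
          (ω n).2.1 = Event.request ∧ (ω n).1 ∈ A : Finset ℕ) : Set ℕ) := by
      ext n
      simp only [Set.mem_ofPred_eq, Finset.coe_filter, Finset.mem_range, hiff]
    rw [requestCount, hset, Set.ncard_coe_finset, Finset.card_filter, stepCount]
    push_cast
    rfl

/-- The long-run ratio of two request counts is almost surely the ratio of the stationary
probabilities. -/
lemma integral_limsup_requestCount_ratio (M : MarkovMachine) (A B : Set State)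
    (hB : M.stationaryProb B ≠ 0) :
    ∫ ω, limsup (fun T : ℝ => requestCount A ω T / requestCount B ω T) atTop ∂M.processLaw =
      M.stationaryProb A / M.stationaryProb B := by
  have h : (fun ω => limsup (fun T : ℝ => requestCount A ω T / requestCount B ω T) atTop)
      =ᵐ[M.processLaw] fun _ => M.stationaryProb A / M.stationaryProb B := by
    filter_upwards [M.ae_tendsto_stepCount_ratio A B hB, M.ae_monotone_eventTime,
      M.ae_tendsto_eventTime_atTop] with ω h1 h2 h3
    obtain ⟨N, hN, hc⟩ := exists_requestCount_eq_stepCount h2 h3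
    simp only [hc]
    exact (h1.comp hN).limsup_eq
  rw [integral_congr_ae h]
  simp

/-! ### The two error ratios -/

lemma FAR_eq (M : MarkovMachine) :
    M.FAR = M.stationary s10 / (M.stationary s10 + M.stationary s00) := by
  have h1 : M.stationaryProb acceptStates = M.stationary s10 + M.stationary s00 := by
    simp [stationaryProb, sum_state, acceptStates, State.estimate, s00, s10, s01, s11, s02, s12,
      s22, add_comm]
  have h2 : M.stationaryProb falseAcceptStates = M.stationary s10 := by
    simp [stationaryProb, sum_state, falseAcceptStates, State.estimate, State.machine, s00, s10,
      s01, s11, s02, s12, s22]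
  rw [FAR, integral_limsup_requestCount_ratio, h1, h2]
  rw [h1]
  exact (add_pos (M.stationary_pos _) (M.stationary_pos _)).ne'

lemma FRR_eq (M : MarkovMachine) :
    M.FRR = (M.stationary s02 + M.stationary s01) / (M.stationary s02 + M.stationary s01 +
      M.stationary s12 + M.stationary s11 + M.stationary s22) := by
  have h1 : M.stationaryProb rejectStates = M.stationary s02 + M.stationary s01 +
      M.stationary s12 + M.stationary s11 + M.stationary s22 := by
    simp [stationaryProb, sum_state, rejectStates, State.estimate, s00, s10, s01, s11, s02, s12,
      s22]
    ring
  have h2 : M.stationaryProb falseRejectStates = M.stationary s02 + M.stationary s01 := by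
    simp [stationaryProb, sum_state, falseRejectStates, State.estimate, State.machine, s00, s10,
      s01, s11, s02, s12, s22, add_comm]
  have hp := M.stationary_pos
  rw [FRR, integral_limsup_requestCount_ratio, h1, h2]
  rw [h1]
  exact (by linarith [hp s02, hp s01, hp s12, hp s11, hp s22] : (0 : ℝ) < _).ne'

end MarkovMachine

theorem mainTheorem3 (M : MarkovMachine) :
    ∃ π : MarkovMachine.State → ℝ,
      M.IsStationary π ∧ (∀ π', M.IsStationary π' → π' = π) ∧
      M.FAR = π MarkovMachine.s10 / (π MarkovMachine.s10 + π MarkovMachine.s00) ∧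
      M.FAR = M.α / (M.μ + M.κ) ∧
      M.FRR = (π MarkovMachine.s02 + π MarkovMachine.s01) /
        (π MarkovMachine.s02 + π MarkovMachine.s01 + π MarkovMachine.s12 +
          π MarkovMachine.s11 + π MarkovMachine.s22) ∧
      M.FRR = M.γ * M.β * (M.μ * (M.lam + M.α) + M.lam * M.κ) /
        ((M.α * M.γ + M.lam * M.β) * M.μ ^ 2 + M.βt * M.μ +
          M.γ * M.lam * (M.β + M.α) * M.κ) :=
  ⟨M.stationary, M.isStationary_stationary, fun _ h => h.eq_stationary, M.FAR_eq,
    M.FAR_eq.trans M.stationary_falseAccept_ratio, M.FRR_eq,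
    M.FRR_eq.trans M.stationary_falseReject_ratio⟩
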